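/- Let $n\ge 1$ be an integer. Let $p_1,\dots,p_r$ be distinct primes, $N=p_1\cdots p_r$ and $R=\mathbb Z/N\mathbb Z$. The space of directions in $R^n$ is the product $\mathbb P\mathbb F_{p_1}^{n-1}\times\cdots\times\mathbb P\mathbb F_{p_r}^{n-1}$, where $\mathbb P\mathbb F_{p}^{n-1}$ is the set of non-zero vectors of $\mathbb F_p^n$ up to scaling by $\mathbb F_p^\times$. A vector $b\in R^n$ represents the direction $(d_1,\dots,d_r)$ if, for every $i$, the reduction $b \bmod p_i\in\mathbb F_{p_i}^n$ is non-zero and has class $d_i$. (By the Chinese remainder theorem every direction has a representative, which is unique up to multiplication by a unit of $R$.) A set $S\subseteq R^n$ is a Kakeya set if for every direction, with representative $b$, there is a point $a\in R^n$ such that the line $\{a+tb : t\in R\}$ is contained in $S$. (1) Every Kakeya set $S\subseteq (\mathbb Z/N\mathbb Z)^n$ satisfies $$|S|\ \ge\ \frac{N^n}{\prod_{i=1}^r (2-1/p_i)^n}\ \ge\ \frac{N^n}{2^{rn}}.$$ (2) Consequently, the Kakeya set conjecture of Hickman and Wright holds for square-free moduli, with the above notion of direction: for every $\epsilon>0$ there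 is a constant $C_{n,\epsilon}>0$, depending only on $n$ and $\epsilon$, such that for every square-free integer $N\ge 1$ every Kakeya set $S\subseteq(\mathbb Z/N\mathbb Z)^n$ satisfies $|S|\ge C_{n,\epsilon}\,N^{n-\epsilon}$. -/

import Mathlib

open scoped LinearAlgebra.Projectivization

/-- The coordinatewise reduction `(ℤ/Nℤ)ⁿ → (ℤ/pᵢℤ)ⁿ`, where `N = ∏ i, p i`. -/
def reduceMod {r n : ℕ} (p : Fin r → ℕ) (i : Fin r) (b : Fin n → ZMod (∏ i, p i)) :
    Fin n → ZMod (p i) :=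
  fun j => ZMod.castHom (Finset.dvd_prod_of_mem p (Finset.mem_univ i)) (ZMod (p i)) (b j)

/-- The space of directions in `(ℤ/Nℤ)ⁿ`, `N = ∏ i, p i`: the product of the projective
spaces of the vector spaces `(ℤ/pᵢℤ)ⁿ`. -/
abbrev Direction {r : ℕ} (n : ℕ) (p : Fin r → ℕ) [∀ i, Fact (p i).Prime] : Type :=
  ∀ i, ℙ (ZMod (p i)) (Fin n → ZMod (p i))

/-- The vector `b` over `ℤ/Nℤ` represents the direction `d`: for every `i`, the reduction of `b`
modulo `p i` is non-zero and its class in the projective space is `d i`. -/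
def Represents {r n : ℕ} (p : Fin r → ℕ) [∀ i, Fact (p i).Prime]
    (b : Fin n → ZMod (∏ i, p i)) (d : Direction n p) : Prop :=
  ∀ i, ∃ h : reduceMod p i b ≠ 0, Projectivization.mk (ZMod (p i)) (reduceMod p i b) h = d i

/-- The line `{a + t b | t ∈ R}` in `Rⁿ`. -/
def line {R : Type*} [CommRing R] {n : ℕ} (a b : Fin n → R) : Set (Fin n → R) :=
  {x | ∃ t : R, x = a + t • b}

/-- `S` is a Kakeya set: it contains a line in every direction. (The family of lines in a
direction does not depend on the chosen representative `b`, and a representative always exists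
when the primes are distinct.) -/
def IsKakeya {r n : ℕ} (p : Fin r → ℕ) [∀ i, Fact (p i).Prime]
    (S : Set (Fin n → ZMod (∏ i, p i))) : Prop :=
  ∀ d : Direction n p, ∃ b, Represents p b d ∧ ∃ a, line a b ⊆ S

/-! For one prime, the bound is proved in a form linear in the set of directions: if `T` in
`F_p^(n+1)` contains a line in direction `(1, c)` for each `c ∈ D`, then `|T| ≥ p / (2 - 1/p)^(n+1)
* |D|` (`div_mul_card_le`). Linearity in `|D|`, for arbitrary `D`, lets the bound multiply over the
primes by slicing (`prod_mul_card_le_card`). The directions `(1, c)` alone suffice, since there are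
`p^n` of them for each prime.

The one-prime bound is a method of multiplicities adapted to `D`. For a shift `g`, take the span of
the Newton polynomials of those multidegrees `α` for which the residue vector of `α + g` lies in
`D`. A member vanishing to order `m` on `T` is restricted to the line attached to its leading `α`,
keeping transverse variables: one coefficient vanishes by degree reasons, yet is a nonzero multiple
of the leading coefficient (`taylorCoeffs_injective`). Comparing dimensions, averaging over `g` and
letting `m` grow gives the constant. -/

namespace Polynomial

/-! ### Univariate polynomials: roots repeated modulo `p`, and vanishing with multiplicity. -/

/-- The exponents `s < k` congruent to `k` modulo `p`. -/
theorem filter_range_natCast_eq (p : ℕ) [hp : Fact p.Prime] (k : ℕ) :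
    (Finset.range k).filter (fun s : ℕ => (s : ZMod p) = (k : ZMod p)) =
      (Finset.range (k / p)).image (fun u => k % p + p * u) := by
  have hpos := hp.out.pos
  ext s
  simp only [Finset.mem_filter, Finset.mem_range, Finset.mem_image, ZMod.natCast_eq_natCast_iff]
  constructor
  · rintro ⟨h1, h2⟩
    have h3 : s % p = k % p := h2
    refine ⟨s / p, ?_, ?_⟩
    · by_contra h
      have h4 : k / p ≤ s / p := not_lt.mp h
      have h5 := Nat.mul_le_mul_left p h4
      have := Nat.div_add_mod s p
      have := Nat.div_add_mod k p
      omega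
    · rw [← h3]; exact Nat.mod_add_div s p
  · rintro ⟨u, hu, rfl⟩
    constructor
    · have := Nat.div_add_mod k p
      have := (Nat.mul_lt_mul_left hpos).2 hu
      omega
    · simp [Nat.ModEq]

theorem card_filter_range_natCast_eq (p : ℕ) [hp : Fact p.Prime] (k : ℕ) :
    ((Finset.range k).filter (fun s : ℕ => (s : ZMod p) = (k : ZMod p))).card = k / p := by
  rw [filter_range_natCast_eq, Finset.card_image_of_injective, Finset.card_range]
  intro u v h
  simpa [hp.out.ne_zero] using h

/-- Besides the `k / p` indices `s < k` congruent to `k`, the index `s = k` also contributes a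
factor `X`, so `X ^ (k / p + 1)` divides the product. -/
theorem coeff_prod_X_add_eq_zero (p : ℕ) [Fact p.Prime] {k l : ℕ} (h : k < l) :
    (∏ s ∈ Finset.range l, (X + C ((k : ZMod p) - (s : ZMod p)))).coeff (k / p) = 0 := by
  have hd : X ^ (k / p + 1) ∣ ∏ s ∈ Finset.range l, (X + C ((k : ZMod p) - (s : ZMod p))) := by
    have hsub : insert k ((Finset.range k).filter (fun s : ℕ => (s : ZMod p) = (k : ZMod p))) ⊆
        Finset.range l := by
      intro s hs
      simp only [Finset.mem_insert, Finset.mem_filter, Finset.mem_range] at hs ⊢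
      omega
    refine dvd_trans ?_ (Finset.prod_dvd_prod_of_subset _ _ _ hsub)
    rw [Finset.prod_congr rfl (g := fun _ => X), Finset.prod_const, Finset.card_insert_of_notMem,
      card_filter_range_natCast_eq]
    · simp
    · intro s hs
      simp only [Finset.mem_insert, Finset.mem_filter] at hs
      rcases hs with rfl | ⟨-, hs⟩ <;> simp [*]
  exact X_pow_dvd_iff.1 hd _ (Nat.lt_succ_self _)

/-- Exactly `k / p` factors equal `X`; the others have nonzero constant term. -/
theorem coeff_prod_X_add_ne_zero (p : ℕ) [Fact p.Prime] (k : ℕ) :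
    (∏ s ∈ Finset.range k, (X + C ((k : ZMod p) - (s : ZMod p)))).coeff (k / p) ≠ 0 := by
  rw [← Finset.prod_filter_mul_prod_filter_not _ (fun s : ℕ => (s : ZMod p) = (k : ZMod p)),
    Finset.prod_congr rfl (g := fun _ => X), Finset.prod_const, card_filter_range_natCast_eq,
    coeff_X_pow_mul', if_pos le_rfl, Nat.sub_self, coeff_zero_prod, Finset.prod_ne_zero_iff]
  · intro s hs
    simp only [Finset.mem_filter] at hs
    simpa [sub_eq_zero] using fun h : (k : ZMod p) = s => hs.2 h.symm
  · intro s hs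
    simp only [Finset.mem_filter] at hs
    simp [hs.2]

theorem eq_zero_of_forall_X_pow_dvd_taylor {F : Type*} [Field F] [Fintype F] {f : F[X]} {k : ℕ}
    (h : ∀ t, X ^ k ∣ taylor t f) (hf : f.natDegree < Fintype.card F * k) : f = 0 := by
  by_contra h0
  have h1 : ∀ t : F, (X - C t) ^ k ∣ f := by
    intro t
    obtain ⟨q, hq⟩ := h t
    refine ⟨taylor (-t) q, ?_⟩
    have := congrArg (taylor (-t)) hq
    rw [taylor_taylor, taylor_mul, taylor_pow] at this
    simpa [sub_eq_add_neg] using this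
  have h2 : ∏ t : F, (X - C t) ^ k ∣ f :=
    Finset.prod_dvd_of_coprime
      (fun s _ t _ hst => (pairwise_coprime_X_sub_C Function.injective_id hst).pow)
      (fun t _ => h1 t)
  have h3 := natDegree_le_of_dvd h2 h0
  rw [natDegree_prod_of_monic _ _ (fun t _ => (monic_X_sub_C t).pow k)] at h3
  simp [natDegree_pow] at h3
  omega

end Polynomial

/-! ### Top-degree homogeneous parts, and coefficients of products in separate variables. -/

namespace MvPolynomial

/-- Every monomial of `f` has degree less than `e`. -/
def DegreeBelow {σ R : Type*} [CommSemiring R] (f : MvPolynomial σ R) (e : ℕ) : Prop :=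
  ∀ μ, f.coeff μ ≠ 0 → μ.degree < e

theorem DegreeBelow.add {σ R : Type*} [CommSemiring R] {f g : MvPolynomial σ R} {e : ℕ}
    (hf : f.DegreeBelow e) (hg : g.DegreeBelow e) : (f + g).DegreeBelow e := by
  intro μ h
  by_cases h1 : f.coeff μ = 0
  · exact hg μ fun h2 => h (by simp [h1, h2])
  · exact hf μ h1

theorem DegreeBelow.mul {σ R : Type*} [CommSemiring R] {f g : MvPolynomial σ R} {d e : ℕ}
    (hf : f.DegreeBelow d) (hg : g.DegreeBelow (e + 1)) : (f * g).DegreeBelow (d + e) := by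
  classical
  intro μ h
  rw [coeff_mul] at h
  obtain ⟨⟨x, y⟩, hx, hxy⟩ := Finset.exists_ne_zero_of_sum_ne_zero h
  have h1 := hf x (left_ne_zero_of_mul hxy)
  have h2 := hg y (right_ne_zero_of_mul hxy)
  rw [Finset.HasAntidiagonal.mem_antidiagonal] at hx
  have h3 : x.degree + y.degree = μ.degree := by rw [← hx, map_add]
  omega

theorem IsHomogeneous.degreeBelow {σ R : Type*} [CommSemiring R] {f : MvPolynomial σ R} {e : ℕ}
    (hf : f.IsHomogeneous e) : f.DegreeBelow (e + 1) := by
  intro μ h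
  have := hf h
  rw [show Finsupp.weight (1 : σ → ℕ) μ = μ.degree from
    (DFunLike.congr_fun (Finsupp.degree_eq_weight_one (R := ℕ) (σ := σ)) μ).symm] at this
  omega

/-- `f` has degree at most `e`, and `g` is its homogeneous component of degree `e`. -/
structure HasTopPart {σ R : Type*} [CommRing R] (f g : MvPolynomial σ R) (e : ℕ) : Prop where
  isHomogeneous : g.IsHomogeneous e
  sub : (f - g).DegreeBelow e

namespace HasTopPart

variable {σ R : Type*} [CommRing R] {f g f' g' : MvPolynomial σ R} {d e : ℕ}

theorem degreeBelow (h : HasTopPart f g e) : f.DegreeBelow (e + 1) := by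
  have h1 : (f - g).DegreeBelow (e + 1) := fun μ hμ => (h.sub μ hμ).trans (Nat.lt_succ_self e)
  simpa using h1.add h.isHomogeneous.degreeBelow

theorem coeff_eq (h : HasTopPart f g e) {μ : σ →₀ ℕ} (hμ : e ≤ μ.degree) :
    f.coeff μ = g.coeff μ := by
  by_contra hne
  exact absurd (h.sub μ (by simpa [sub_eq_zero] using hne)) (not_lt.2 hμ)

theorem one : HasTopPart (1 : MvPolynomial σ R) 1 0 :=
  ⟨isHomogeneous_one σ R, fun μ h => absurd (by simp) h⟩

theorem mul (h : HasTopPart f g d) (h' : HasTopPart f' g' e) :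
    HasTopPart (f * f') (g * g') (d + e) := by
  refine ⟨h.isHomogeneous.mul h'.isHomogeneous, ?_⟩
  have h1 := h.sub.mul h'.degreeBelow
  have h2 := h'.sub.mul h.isHomogeneous.degreeBelow
  rw [add_comm e d] at h2
  have := h1.add h2
  convert this using 1
  ring

theorem prod {ι : Type*} (s : Finset ι) {f g : ι → MvPolynomial σ R} {e : ι → ℕ}
    (h : ∀ i ∈ s, HasTopPart (f i) (g i) (e i)) :
    HasTopPart (∏ i ∈ s, f i) (∏ i ∈ s, g i) (∑ i ∈ s, e i) := by
  classical
  induction s using Finset.induction_on with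
  | empty => simpa using one
  | insert a s ha ih =>
    rw [Finset.prod_insert ha, Finset.prod_insert ha, Finset.sum_insert ha]
    exact (h a (Finset.mem_insert_self a s)).mul
      (ih fun i hi => h i (Finset.mem_insert_of_mem hi))

theorem pow (h : HasTopPart f g d) (k : ℕ) : HasTopPart (f ^ k) (g ^ k) (k * d) := by
  simpa using prod (Finset.range k) (fun _ _ => h)

theorem C_add (r : R) (h : g.IsHomogeneous 1) : HasTopPart (C r + g) g 1 := by
  classical
  refine ⟨h, fun μ hμ => ?_⟩
  rw [add_sub_cancel_right, coeff_C] at hμ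
  have : μ = 0 := by
    by_contra h0
    exact hμ (if_neg fun h => h0 h.symm)
  simp [this]

end HasTopPart

theorem coeff_prod_toMvPolynomial {n : ℕ} {R : Type*} [CommRing R] (f : Fin n → Polynomial R)
    (i : Fin n →₀ ℕ) :
    (∏ j, (f j).toMvPolynomial j).coeff i = ∏ j, (f j).coeff (i j) := by
  classical
  have h1 : ∀ j, (f j).toMvPolynomial j =
      ∑ k ∈ (f j).support, C ((f j).coeff k) * X j ^ k := by
    intro j
    conv_lhs => rw [(f j).as_sum_support_C_mul_X_pow]
    simp [Polynomial.toMvPolynomial]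
  have h2 : ∀ κ : Fin n → ℕ, (∏ j, (C ((f j).coeff (κ j)) * X j ^ κ j : MvPolynomial (Fin n) R)) =
      monomial (Finsupp.equivFunOnFinite.symm κ) (∏ j, (f j).coeff (κ j)) := by
    intro κ
    rw [Finset.prod_mul_distrib, ← map_prod, monomial_eq]
    congr 1
    rw [Finsupp.prod_fintype _ _ (by simp)]
    simp
  have h3 : ∀ κ : Fin n → ℕ, Finsupp.equivFunOnFinite.symm κ = i ↔ κ = i := fun κ => by
    rw [Equiv.symm_apply_eq]; rfl
  simp_rw [h1, Finset.prod_univ_sum, h2, coeff_sum, coeff_monomial, h3]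
  rw [Finset.sum_ite_eq']
  split_ifs with h
  · rfl
  · rw [Fintype.mem_piFinset] at h
    push Not at h
    obtain ⟨j, hj⟩ := h
    exact (Finset.prod_eq_zero (Finset.mem_univ j) (by simpa using hj)).symm

end MvPolynomial

/-! ### Taylor expansion and substitution along a line with transverse variables. -/

namespace MvPolynomial

variable {n : ℕ} {F : Type*} [CommRing F]

/-- The Taylor expansion of a polynomial at `x`. -/
noncomputable def taylorAt {σ : Type*} (x : σ → F) : MvPolynomial σ F →ₐ[F] MvPolynomial σ F :=
  aeval fun j => X j + C (x j)

/-- The affine substitution `z ↦ a + z₀ (1, c) + (0, z')`, where `z = (z₀, z')`. -/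
noncomputable def alongLine (a : Fin (n + 1) → F) (c : Fin n → F) :
    MvPolynomial (Fin (n + 1)) F →ₐ[F] MvPolynomial (Fin (n + 1)) F :=
  aeval (Fin.cons (C (a 0) + X 0) fun j => C (a j.succ) + (C (c j) * X 0 + X j.succ))

/-- View a polynomial in `z₀, …, zₙ` as one in `z₁, …, zₙ` over `F[z₀]`. -/
noncomputable def toUnivariateCoeffs :
    MvPolynomial (Fin (n + 1)) F →ₐ[F] MvPolynomial (Fin n) (Polynomial F) :=
  aeval (Fin.cons (C Polynomial.X) X)

theorem coeff_toUnivariateCoeffs (G : MvPolynomial (Fin (n + 1)) F) (i : Fin n →₀ ℕ) (l : ℕ) :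
    ((toUnivariateCoeffs G).coeff i).coeff l = G.coeff (i.cons l) := by
  classical
  induction G using MvPolynomial.induction_on' with
  | add p q hp hq => rw [map_add, coeff_add, Polynomial.coeff_add, coeff_add, hp, hq]
  | monomial α r =>
    have h : toUnivariateCoeffs (monomial α r) =
        monomial α.tail (Polynomial.C r * Polynomial.X ^ α 0) := by
      rw [toUnivariateCoeffs, aeval_monomial, monomial_eq, Finsupp.prod_fintype _ _ (by simp),
        Finsupp.prod_fintype _ _ (by simp), Fin.prod_univ_succ, map_mul, map_pow, mul_assoc]
      simp [Finsupp.tail_apply, algebraMap_apply]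
    rw [h, coeff_monomial, coeff_monomial]
    have : α = i.cons l ↔ α.tail = i ∧ α 0 = l :=
      ⟨fun h => by simp [h], fun ⟨h1, h2⟩ => by rw [← h1, ← h2, Finsupp.cons_tail]⟩
    by_cases h1 : α.tail = i <;> simp [this, h1, Polynomial.coeff_X_pow, eq_comm]

theorem toUnivariateCoeffs_taylorAt (G : MvPolynomial (Fin (n + 1)) F) (t : F) :
    toUnivariateCoeffs (taylorAt (Fin.cons t 0) G) =
      map (Polynomial.taylorAlgHom t : Polynomial F →+* Polynomial F) (toUnivariateCoeffs G) := by
  induction G using MvPolynomial.induction_on with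
  | C r => simp [toUnivariateCoeffs, taylorAt, algebraMap_apply]
  | add p q hp hq => rw [map_add, map_add, hp, hq, map_add, map_add]
  | mul_X p j hp =>
    rw [map_mul, map_mul, hp, map_mul, map_mul]
    refine congrArg₂ (· * ·) rfl ?_
    refine Fin.cases ?_ (fun j => ?_) j <;>
    simp [toUnivariateCoeffs, taylorAt, algebraMap_apply]

/-- Expanding at `z₀ = t`, `z' = 0` after the substitution is the same as applying its linear part
to the expansion at `a + t(1, c)`, and a linear substitution preserves the ideal of the variables.
-/
theorem mem_pow_idealOfVars_of_taylorAt {P : MvPolynomial (Fin (n + 1)) F} {m : ℕ}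
    {a : Fin (n + 1) → F} {c : Fin n → F} (t : F)
    (h : taylorAt (a + t • (Fin.cons 1 c : Fin (n + 1) → F)) P ∈ idealOfVars _ F ^ m) :
    taylorAt (Fin.cons t 0) (alongLine a c P) ∈ idealOfVars (Fin (n + 1)) F ^ m := by
  have h1 : taylorAt (Fin.cons t 0) (alongLine a c P) =
      alongLine 0 c (taylorAt (a + t • (Fin.cons 1 c : Fin (n + 1) → F)) P) := by
    rw [← AlgHom.comp_apply, ← AlgHom.comp_apply]
    refine DFunLike.congr_fun (algHom_ext fun j => ?_) P
    refine Fin.cases ?_ (fun j => ?_) j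
    · simp [taylorAt, alongLine]; ring
    · simp [taylorAt, alongLine]; ring
  have h2 : (idealOfVars (Fin (n + 1)) F).map (alongLine (0 : Fin (n + 1) → F) c) ≤
      idealOfVars _ F := by
    rw [Ideal.map_span, Ideal.span_le]
    have hX : ∀ j, (X j : MvPolynomial (Fin (n + 1)) F) ∈ idealOfVars _ F :=
      fun j => Ideal.subset_span ⟨j, rfl⟩
    rintro _ ⟨_, ⟨j, rfl⟩, rfl⟩
    refine Fin.cases ?_ (fun j => ?_) j
    · simpa [alongLine] using hX 0
    · simpa [alongLine] using Ideal.add_mem _ (Ideal.mul_mem_left _ _ (hX 0)) (hX j.succ)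
  rw [h1]
  refine Ideal.pow_right_mono h2 m ?_
  rw [← Ideal.map_pow]
  exact Ideal.mem_map_of_mem _ h

/-- Taking the coefficient of `z'^i` costs `|i|` both in degree and in order of vanishing. What
remains is a polynomial in `z₀` with more zeros, counted with multiplicity, than its degree. -/
theorem coeff_toUnivariateCoeffs_alongLine_eq_zero {F : Type*} [Field F] [Fintype F]
    {P : MvPolynomial (Fin (n + 1)) F} {m e : ℕ} {a : Fin (n + 1) → F} {c : Fin n → F}
    (h : ∀ t : F, taylorAt (a + t • (Fin.cons 1 c : Fin (n + 1) → F)) P ∈ idealOfVars _ F ^ m)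
    (he : (alongLine a c P).DegreeBelow (e + 1)) (i : Fin n →₀ ℕ)
    (hi : e - i.degree < Fintype.card F * (m - i.degree)) :
    (toUnivariateCoeffs (alongLine a c P)).coeff i = 0 := by
  have hdeg : ∀ (i : Fin n →₀ ℕ) (l : ℕ), (i.cons l).degree = l + i.degree := by
    intro i l
    simp [Finsupp.degree_eq_sum, Fin.sum_univ_succ]
  refine Polynomial.eq_zero_of_forall_X_pow_dvd_taylor (k := m - i.degree) (fun t => ?_)
    (lt_of_le_of_lt ?_ hi)
  · rw [Polynomial.X_pow_dvd_iff]
    intro l hl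
    have h1 := (mem_pow_idealOfVars_iff' _ _).1 (mem_pow_idealOfVars_of_taylorAt t (h t))
      (i.cons l) (by rw [hdeg]; omega)
    rw [← coeff_toUnivariateCoeffs, toUnivariateCoeffs_taylorAt, coeff_map] at h1
    exact h1
  · refine Polynomial.natDegree_le_iff_coeff_eq_zero.2 fun l hl => ?_
    rw [coeff_toUnivariateCoeffs]
    by_contra hne
    have := he _ hne
    rw [hdeg] at this
    omega

/-- Setting `z₀ = 1`. -/
noncomputable def dehomogenize : MvPolynomial (Fin (n + 1)) F →ₐ[F] MvPolynomial (Fin n) F :=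
  aeval (Fin.cons 1 X)

theorem IsHomogeneous.coeff_dehomogenize {G : MvPolynomial (Fin (n + 1)) F} {e : ℕ}
    (hG : G.IsHomogeneous e) {i : Fin n →₀ ℕ} (hi : i.degree ≤ e) :
    (dehomogenize G).coeff i = G.coeff (i.cons (e - i.degree)) := by
  classical
  conv_lhs => rw [G.as_sum, map_sum, coeff_sum]
  have h : ∀ α r, dehomogenize (monomial α r : MvPolynomial (Fin (n + 1)) F) =
      monomial α.tail r := by
    intro α r
    rw [dehomogenize, aeval_monomial, monomial_eq, Finsupp.prod_fintype _ _ (by simp),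
      Finsupp.prod_fintype _ _ (by simp), Fin.prod_univ_succ]
    simp [Finsupp.tail_apply, algebraMap_eq]
  have h' : ∀ α ∈ G.support, (α.tail = i ↔ α = i.cons (e - i.degree)) := by
    intro α hα
    have h1 : α.degree = e := by
      have := hG (mem_support_iff.1 hα)
      rwa [show Finsupp.weight (1 : Fin (n + 1) → ℕ) α = α.degree from
        (DFunLike.congr_fun (Finsupp.degree_eq_weight_one (R := ℕ)) α).symm] at this
    constructor
    · rintro rfl
      conv_lhs => rw [← Finsupp.cons_tail α]
      congr 1
      rw [← h1, Finsupp.degree_eq_sum, Finsupp.degree_eq_sum, Fin.sum_univ_succ]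
      simp [Finsupp.tail_apply]
    · rintro rfl
      exact Finsupp.tail_cons _ _
  rw [Finset.sum_congr rfl (g := fun α => if α = i.cons (e - i.degree) then G.coeff α else 0)]
  · rw [Finset.sum_ite_eq']
    split_ifs with h1
    · rfl
    · exact (notMem_support_iff.1 h1).symm
  · intro α hα
    rw [h, coeff_monomial]
    simp only [h' α hα]

end MvPolynomial

open MvPolynomial

/-! ### Newton polynomials and their independence modulo high-order vanishing. -/

/-- The exponent vectors of total degree less than `m`. -/
def exponentsBelow (n m : ℕ) : Finset (Fin n →₀ ℕ) :=
  (Finset.range m).biUnion fun k => Finset.univ.finsuppAntidiag k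

theorem mem_exponentsBelow {n m : ℕ} {α : Fin n →₀ ℕ} : α ∈ exponentsBelow n m ↔ α.degree < m := by
  simp [exponentsBelow, Finsupp.degree_eq_sum]

theorem card_exponentsBelow (n m : ℕ) :
    (exponentsBelow (n + 1) m).card = (m + n).choose (n + 1) := by
  have h : (exponentsBelow (n + 1) m).card =
      ∑ k ∈ Finset.range m, (Finset.univ.finsuppAntidiag k : Finset (Fin (n + 1) →₀ ℕ)).card := by
    refine Finset.card_biUnion fun k _ l _ hkl => ?_
    refine Finset.disjoint_left.2 ?_
    intro α h1 h2
    rw [Finset.mem_finsuppAntidiag] at h1 h2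
    exact hkl (h1.1.symm.trans h2.1)
  rw [h]
  clear h
  induction m with
  | zero => simp
  | succ m ih =>
    rw [Finset.sum_range_succ, ih, Finset.card_finsuppAntidiag_nat_eq_choose, Finset.card_univ,
      Fintype.card_fin, show m + 1 + n = (m + n) + 1 by omega, Nat.choose_succ_succ,
      show n + 1 + m - 1 = m + n by omega, add_comm, ← Nat.choose_symm_add (a := m)]

/-- The Newton-type homogeneous polynomial of multidegree `α`: its dehomogenization is a product of
univariate polynomials with roots `g j, g j + 1, …, g j + α (j + 1) - 1`. -/
noncomputable def newtonPoly {p n : ℕ} (g : Fin n → ZMod p) (α : Fin (n + 1) →₀ ℕ) :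
    MvPolynomial (Fin (n + 1)) (ZMod p) :=
  X 0 ^ α 0 * ∏ j : Fin n, ∏ s ∈ Finset.range (α j.succ), (X j.succ - C ((s : ZMod p) + g j) * X 0)

/-- The top homogeneous part of `newtonPoly g α` along a line in direction `(1, c)`. -/
noncomputable def newtonPolyTop {p n : ℕ} (g c : Fin n → ZMod p) (α : Fin (n + 1) →₀ ℕ) :
    MvPolynomial (Fin (n + 1)) (ZMod p) :=
  X 0 ^ α 0 * ∏ j : Fin n, ∏ s ∈ Finset.range (α j.succ),
    (X j.succ + C (c j - g j - (s : ZMod p)) * X 0)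

theorem hasTopPart_alongLine_newtonPoly {p n : ℕ} (a : Fin (n + 1) → ZMod p)
    (g c : Fin n → ZMod p) (α : Fin (n + 1) →₀ ℕ) :
    HasTopPart (alongLine a c (newtonPoly g α)) (newtonPolyTop g c α) α.degree := by
  have hX : ∀ i, (X i : MvPolynomial (Fin (n + 1)) (ZMod p)).IsHomogeneous 1 :=
    isHomogeneous_X _
  have h1 : HasTopPart (C (a 0) + X 0 : MvPolynomial (Fin (n + 1)) (ZMod p)) (X 0) 1 :=
    HasTopPart.C_add _ (hX 0)
  have h2 : ∀ (j : Fin n) (s : ℕ),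
      HasTopPart (alongLine a c (X j.succ - C ((s : ZMod p) + g j) * X 0))
        (X j.succ + C (c j - g j - (s : ZMod p)) * X 0) 1 := by
    intro j s
    convert HasTopPart.C_add (a j.succ - ((s : ZMod p) + g j) * a 0)
      (g := (X j.succ + C (c j - g j - (s : ZMod p)) * X 0 :
        MvPolynomial (Fin (n + 1)) (ZMod p))) ?_ using 1
    · simp [alongLine, algebraMap_eq]
      ring
    · exact (hX _).add (by simpa using (isHomogeneous_C _ (c j - g j - (s : ZMod p))).mul (hX 0))
  have h3 : α.degree = α 0 * 1 + ∑ j : Fin n, ∑ s ∈ Finset.range (α j.succ), 1 := by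
    simp [Finsupp.degree_eq_sum, Fin.sum_univ_succ]
  rw [h3, newtonPoly, newtonPolyTop, map_mul, map_pow, map_prod]
  refine HasTopPart.mul (HasTopPart.pow ?_ _) (HasTopPart.prod _ fun j _ => ?_)
  · simpa [alongLine] using h1
  · rw [map_prod]
    exact HasTopPart.prod _ fun s _ => h2 j s

/-- Setting `z₀ = 1` loses nothing on a homogeneous polynomial and turns this one into a product of
univariate polynomials in distinct variables. -/
theorem coeff_newtonPolyTop {p n : ℕ} (g c : Fin n → ZMod p) (α : Fin (n + 1) →₀ ℕ)
    {i : Fin n →₀ ℕ} (hi : i.degree ≤ α.degree) :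
    (newtonPolyTop g c α).coeff (i.cons (α.degree - i.degree)) =
      ∏ j : Fin n, (∏ s ∈ Finset.range (α j.succ),
        (Polynomial.X + Polynomial.C (c j - g j - (s : ZMod p)))).coeff (i j) := by
  rw [← (hasTopPart_alongLine_newtonPoly 0 g c α).isHomogeneous.coeff_dehomogenize hi,
    ← coeff_prod_toMvPolynomial]
  congr 1
  simp [newtonPolyTop, dehomogenize, Polynomial.toMvPolynomial, algebraMap_eq]

/-- The coefficients of degree less than `m` of the Taylor expansions at the points of `T` of a
linear combination of the polynomials `newtonPoly g α`, `α ∈ A`. -/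
noncomputable def taylorCoeffs {p n : ℕ} (g : Fin n → ZMod p) (A : Finset (Fin (n + 1) →₀ ℕ))
    (T : Finset (Fin (n + 1) → ZMod p)) (m : ℕ) :
    (A → ZMod p) →ₗ[ZMod p] (T × exponentsBelow (n + 1) m → ZMod p) :=
  LinearMap.pi fun xμ => (lcoeff (ZMod p) xμ.2.1) ∘ₗ (taylorAt xμ.1.1).toLinearMap ∘ₗ
    Fintype.linearCombination (ZMod p) fun α : A => newtonPoly g α.1

theorem taylorCoeffs_injective {p n : ℕ} [hp : Fact p.Prime] (g : Fin n → ZMod p)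
    (A : Finset (Fin (n + 1) →₀ ℕ)) (T : Finset (Fin (n + 1) → ZMod p)) (m : ℕ)
    (hA : ∀ α ∈ A, (2 * p - 1) * α.degree < p ^ 2 * m)
    (hT : ∀ α ∈ A, ∃ a, ∀ t : ZMod p,
      a + t • (Fin.cons 1 fun j => (α j.succ : ZMod p) + g j : Fin (n + 1) → ZMod p) ∈ T) :
    Function.Injective (taylorCoeffs g A T m) := by
  rw [← LinearMap.ker_eq_bot, LinearMap.ker_eq_bot']
  intro f hf
  by_contra hne
  obtain ⟨α₀, hα₀⟩ := Function.ne_iff.1 hne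
  -- The tie-break by `α 0` ensures that any other `β` of the same degree in the support of `f`
  -- exceeds `α` in some coordinate `j.succ`.
  obtain ⟨α, hα, hmax⟩ := Finset.exists_max_image (Finset.univ.filter fun α : A => f α ≠ 0)
    (fun α => toLex (α.1.degree, α.1 0)) ⟨α₀, by simpa using hα₀⟩
  simp only [Finset.mem_filter, Finset.mem_univ, true_and] at hα hmax
  set c : Fin n → ZMod p := fun j => (α.1 j.succ : ZMod p) + g j with hc
  -- `α j.succ / p` is the exact order at `0` of the `j`-th univariate factor for `α`, because `c -
  -- g` is `α` modulo `p`.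
  set i : Fin n →₀ ℕ := Finsupp.equivFunOnFinite.symm fun j => α.1 j.succ / p with hi
  set e := α.1.degree with he
  obtain ⟨a, ha⟩ := hT α.1 α.2
  set P : MvPolynomial (Fin (n + 1)) (ZMod p) := ∑ β : A, f β • newtonPoly g β.1 with hP
  have hvan : ∀ t : ZMod p, taylorAt (a + t • (Fin.cons 1 c : Fin (n + 1) → ZMod p)) P ∈
      idealOfVars _ (ZMod p) ^ m := by
    intro t
    rw [mem_pow_idealOfVars_iff']
    intro μ hμ
    have := congrFun hf (⟨_, ha t⟩, ⟨μ, mem_exponentsBelow.2 hμ⟩)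
    simpa only [taylorCoeffs, LinearMap.pi_apply, LinearMap.comp_apply, AlgHom.toLinearMap_apply,
      Fintype.linearCombination_apply, lcoeff_apply, Pi.zero_apply] using this
  have hle : ∀ β : A, f β ≠ 0 → β.1.degree ≤ e := by
    intro β hβ
    have := hmax β hβ
    rw [Prod.Lex.toLex_le_toLex] at this
    omega
  have hsum : alongLine a c P = ∑ β : A, f β • alongLine a c (newtonPoly g β.1) := by
    simp [hP]
  have hbelow : (alongLine a c P).DegreeBelow (e + 1) := by
    intro μ hμ
    rw [hsum, coeff_sum] at hμ
    obtain ⟨β, -, hβ⟩ := Finset.exists_ne_zero_of_sum_ne_zero hμ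
    rw [coeff_smul] at hβ
    have h1 := hle β (left_ne_zero_of_mul hβ)
    have h2 := (hasTopPart_alongLine_newtonPoly a g c β.1).degreeBelow μ (right_ne_zero_of_mul hβ)
    omega
  have hpi : p * i.degree ≤ e := by
    rw [he, Finsupp.degree_eq_sum, Finsupp.degree_eq_sum, Fin.sum_univ_succ, Finset.mul_sum]
    refine le_trans (Finset.sum_le_sum fun j _ => ?_) (Nat.le_add_left _ _)
    exact Nat.mul_div_le _ _
  have hp2 := hp.out.two_le
  have hie : i.degree ≤ e := le_trans (Nat.le_mul_of_pos_left _ hp.out.pos) hpi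
  -- The condition amounts to `e + (p - 1)|i| < p m`. As `|i| ≤ e / p`, it follows from `(2p - 1) e
  -- < p² m`; this is the source of the factor `2 - 1/p`.
  have hlt : e - i.degree < Fintype.card (ZMod p) * (m - i.degree) := by
    have h1 := hA α.1 α.2
    rw [← he] at h1
    rw [ZMod.card]
    have h2 : (e : ℤ) - i.degree < p * ((m : ℤ) - i.degree) := by
      zify [show 1 ≤ 2 * p by omega] at h1
      zify at hpi hp2
      nlinarith
    have h3 : i.degree ≤ m := by
      by_contra h
      zify at hie h hp2
      nlinarith
    zify [h3, hie]
    exact h2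
  have hzero : (alongLine a c P).coeff (i.cons (e - i.degree)) = 0 := by
    rw [← coeff_toUnivariateCoeffs, coeff_toUnivariateCoeffs_alongLine_eq_zero hvan hbelow i hlt,
      Polynomial.coeff_zero]
  have hdeg : (i.cons (e - i.degree)).degree = e := by
    rw [Finsupp.degree_eq_sum, Fin.sum_univ_succ]
    simp only [Finsupp.cons_zero, Finsupp.cons_succ]
    rw [← Finsupp.degree_eq_sum]
    omega
  have hother : ∀ β : A, β ≠ α →
      (f β • alongLine a c (newtonPoly g β.1)).coeff (i.cons (e - i.degree)) = 0 := by
    intro β hβ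
    by_cases hfβ : f β = 0
    · simp [hfβ]
    rw [coeff_smul]
    refine mul_eq_zero_of_right _ ?_
    have htop := hasTopPart_alongLine_newtonPoly a g c β.1
    rcases (hle β hfβ).lt_or_eq with hlt | heq
    · by_contra h
      have := htop.degreeBelow _ h
      omega
    · rw [htop.coeff_eq (by omega), ← heq, coeff_newtonPolyTop _ _ _ (by omega)]
      obtain ⟨j, hj⟩ : ∃ j : Fin n, α.1 j.succ < β.1 j.succ := by
        by_contra! hno
        apply hβ
        have h0 : β.1 0 ≤ α.1 0 := by
          have := hmax β hfβ
          rw [Prod.Lex.toLex_le_toLex] at this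
          omega
        rw [he, Finsupp.degree_eq_sum, Finsupp.degree_eq_sum] at heq
        have h1 := (Finset.sum_eq_sum_iff_of_le (s := Finset.univ) (f := ⇑β.1) (g := ⇑α.1)
          (fun j _ => Fin.cases h0 hno j)).1 heq
        exact Subtype.ext (Finsupp.ext fun j => h1 j (Finset.mem_univ j))
      refine Finset.prod_eq_zero (Finset.mem_univ j) ?_
      simpa [hc, hi] using Polynomial.coeff_prod_X_add_eq_zero p hj
  rw [hsum, coeff_sum, Finset.sum_eq_single α (fun β _ => hother β) (by simp), coeff_smul,
    (hasTopPart_alongLine_newtonPoly a g c α.1).coeff_eq (by omega),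
    coeff_newtonPolyTop _ _ _ hie] at hzero
  refine hα ((mul_eq_zero.1 hzero).resolve_right (Finset.prod_ne_zero_iff.2 fun j _ => ?_))
  simpa [hc, hi] using Polynomial.coeff_prod_X_add_ne_zero p (α.1 j.succ)

/-! ### The bound for one prime: dimension count, averaging over shifts, limit. -/

theorem card_le_of_forall_line {p n : ℕ} [Fact p.Prime] (g : Fin n → ZMod p)
    (A : Finset (Fin (n + 1) →₀ ℕ)) (T : Finset (Fin (n + 1) → ZMod p)) (m : ℕ)
    (hA : ∀ α ∈ A, (2 * p - 1) * α.degree < p ^ 2 * m)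
    (hT : ∀ α ∈ A, ∃ a, ∀ t : ZMod p,
      a + t • (Fin.cons 1 fun j => (α j.succ : ZMod p) + g j : Fin (n + 1) → ZMod p) ∈ T) :
    A.card ≤ T.card * (exponentsBelow (n + 1) m).card := by
  have := LinearMap.finrank_le_finrank_of_injective (taylorCoeffs_injective g A T m hA hT)
  simpa [Module.finrank_fintype_fun_eq_card] using this

theorem card_mul_choose_le {p n : ℕ} [hp : Fact p.Prime] (T : Finset (Fin (n + 1) → ZMod p))
    (D : Finset (Fin n → ZMod p))
    (hT : ∀ c ∈ D, ∃ a, ∀ t : ZMod p, a + t • (Fin.cons 1 c : Fin (n + 1) → ZMod p) ∈ T)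
    {d m : ℕ} (hdm : (2 * p - 1) * d ≤ p ^ 2 * m) :
    D.card * (d + n).choose (n + 1) ≤ p ^ n * T.card * (m + n).choose (n + 1) := by
  classical
  have h1 : ∀ g : Fin n → ZMod p,
      ((exponentsBelow (n + 1) d).filter
        fun α => (fun j => (α j.succ : ZMod p) + g j) ∈ D).card ≤
      T.card * (exponentsBelow (n + 1) m).card := by
    intro g
    refine card_le_of_forall_line g _ T m (fun α hα => ?_) (fun α hα => ?_)
    · rw [Finset.mem_filter, mem_exponentsBelow] at hα
      refine lt_of_lt_of_le (Nat.mul_lt_mul_of_pos_left hα.1 ?_) hdm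
      have := hp.out.two_le
      omega
    · exact hT _ (Finset.mem_filter.1 hα).2
  have h2 : ∑ g : Fin n → ZMod p, ((exponentsBelow (n + 1) d).filter
        fun α => (fun j => (α j.succ : ZMod p) + g j) ∈ D).card =
      D.card * (exponentsBelow (n + 1) d).card := by
    simp_rw [Finset.card_filter]
    rw [Finset.sum_comm, mul_comm, ← smul_eq_mul, ← Finset.sum_const]
    refine Finset.sum_congr rfl fun α _ => ?_
    rw [← Finset.card_filter]
    refine Finset.card_bij (fun g _ j => (α j.succ : ZMod p) + g j) (by simp) ?_ ?_
    · intro g _ g' _ h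
      funext j
      simpa using congrFun h j
    · intro c hc
      exact ⟨fun j => c j - α j.succ, by simpa using hc, by simp⟩
  have h3 := Finset.sum_le_sum fun g (_ : g ∈ Finset.univ) => h1 g
  rw [h2, Finset.sum_const, Finset.card_univ, Fintype.card_fun, ZMod.card, Fintype.card_fin,
    smul_eq_mul, card_exponentsBelow, card_exponentsBelow] at h3
  rwa [mul_assoc]

open Filter Topology in
theorem card_mul_pow_le {p n : ℕ} [hp : Fact p.Prime] (T : Finset (Fin (n + 1) → ZMod p))
    (D : Finset (Fin n → ZMod p))
    (hT : ∀ c ∈ D, ∃ a, ∀ t : ZMod p, a + t • (Fin.cons 1 c : Fin (n + 1) → ZMod p) ∈ T) :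
    (D.card : ℝ) * ((p : ℝ) ^ 2) ^ (n + 1) ≤ (p : ℝ) ^ n * T.card * (2 * p - 1) ^ (n + 1) := by
  have hp2 := hp.out.two_le
  have key : ∀ s : ℕ, (D.card : ℝ) * ((p : ℝ) ^ 2 * s) ^ (n + 1) ≤
      (p : ℝ) ^ n * T.card * ((2 * p - 1) * s + n) ^ (n + 1) := by
    intro s
    -- These `d` and `m` make the degree condition an equality; both binomials are then compared
    -- with powers over `(n + 1)!`, and the error `n / s` tends to `0`.
    have h := card_mul_choose_le T D hT (d := p ^ 2 * s) (m := (2 * p - 1) * s) (le_of_eq (by ring))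
    have h1 := Nat.pow_le_choose (α := ℝ) (n + 1) (p ^ 2 * s + n)
    have h2 := Nat.choose_le_pow_div (α := ℝ) (n + 1) ((2 * p - 1) * s + n)
    rw [show p ^ 2 * s + n + 1 - (n + 1) = p ^ 2 * s by omega] at h1
    have h' : (D.card : ℝ) * (p ^ 2 * s + n).choose (n + 1) ≤
      p ^ n * T.card * ((2 * p - 1) * s + n).choose (n + 1) := by exact_mod_cast h
    have hf : (0 : ℝ) < (n + 1).factorial := by positivity
    have h3 := (mul_le_mul_of_nonneg_left h1 (Nat.cast_nonneg D.card)).trans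
      (h'.trans (mul_le_mul_of_nonneg_left h2 (by positivity)))
    rw [← mul_div_assoc, ← mul_div_assoc, div_le_div_iff_of_pos_right hf] at h3
    push_cast [show 1 ≤ 2 * p by omega] at h3
    exact h3
  have hlim : Tendsto (fun s : ℕ => (p : ℝ) ^ n * T.card * ((2 * p - 1) + n / s) ^ (n + 1)) atTop
      (𝓝 ((p : ℝ) ^ n * T.card * ((2 * p - 1) + 0) ^ (n + 1))) :=
    ((tendsto_const_nhds.add (tendsto_const_div_atTop_nhds_zero_nat _)).pow _).const_mul _
  rw [add_zero] at hlim
  refine ge_of_tendsto hlim ?_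
  filter_upwards [eventually_gt_atTop 0] with s hs
  have hs' : (0 : ℝ) < s := by exact_mod_cast hs
  have h := key s
  rw [show (2 * (p : ℝ) - 1) * s + n = ((2 * p - 1) + n / s) * s by field_simp, mul_pow, mul_pow,
    ← mul_assoc, ← mul_assoc] at h
  exact le_of_mul_le_mul_right h (by positivity)

/-- A set containing a line in each direction `(1, c)`, `c ∈ D`, has size at least proportional
to that of `D`. -/
theorem div_mul_card_le {p n : ℕ} [hp : Fact p.Prime] (T : Finset (Fin (n + 1) → ZMod p))
    (D : Finset (Fin n → ZMod p))
    (hT : ∀ c ∈ D, ∃ a, ∀ t : ZMod p, a + t • (Fin.cons 1 c : Fin (n + 1) → ZMod p) ∈ T) :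
    (p : ℝ) / (2 - 1 / p) ^ (n + 1) * D.card ≤ T.card := by
  have h := card_mul_pow_le T D hT
  have hp0 : (0 : ℝ) < p := by exact_mod_cast hp.out.pos
  have hp2 : (2 : ℝ) ≤ p := by exact_mod_cast hp.out.two_le
  have h1 : (0 : ℝ) < 2 - 1 / p := by
    rw [sub_pos, div_lt_iff₀ hp0]
    linarith
  rw [show 2 * (p : ℝ) - 1 = (2 - 1 / p) * p by field_simp, mul_pow] at h
  rw [div_mul_eq_mul_div, div_le_iff₀ (by positivity)]
  refine le_of_mul_le_mul_left ?_ (show (0 : ℝ) < p ^ n * p ^ (n + 1) by positivity)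
  calc (p : ℝ) ^ n * p ^ (n + 1) * (p * D.card) = D.card * (p ^ 2) ^ (n + 1) := by ring
    _ ≤ _ := h
    _ = _ := by ring

/-! ### Multiplicativity over products. -/

/-- Linear lower bounds for the size of a set containing a member of `L i c` for each `c` in a
given set of parameters are multiplicative over products. -/
theorem prod_mul_card_le_card : ∀ {r : ℕ} {X E : Fin r → Type} [∀ i, Fintype (X i)]
    [∀ i, Fintype (E i)] (L : ∀ i, E i → Set (Set (X i))) (κ : Fin r → ℝ) (_ : ∀ i, 0 ≤ κ i)
    (_ : ∀ i (T : Finset (X i)) (D : Finset (E i)), (∀ c ∈ D, ∃ l ∈ L i c, l ⊆ T) →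
      κ i * D.card ≤ T.card)
    (T : Finset (∀ i, X i)) (D : Finset (∀ i, E i))
    (_ : ∀ c ∈ D, ∃ l : ∀ i, Set (X i), (∀ i, l i ∈ L i (c i)) ∧ Set.univ.pi l ⊆ T),
    (∏ i, κ i) * D.card ≤ T.card
  | 0, X, E, _, _, L, κ, _, _, T, D, hT => by
    rcases D.eq_empty_or_nonempty with rfl | ⟨c, hc⟩
    · simp
    · obtain ⟨l, -, hl⟩ := hT c hc
      have h1 : D.card ≤ 1 := Finset.card_le_one_of_subsingleton D
      have h2 : 1 ≤ T.card := Finset.card_pos.2 ⟨finZeroElim, hl fun i => i.elim0⟩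
      simpa using h1.trans h2
  | r + 1, X, E, _, _, L, κ, hκ, hL, T, D, hT => by
    classical
    have ih := prod_mul_card_le_card (fun i : Fin r => L i.succ) (fun i => κ i.succ)
      (fun i => hκ _) (fun i => hL _)
    set Tx : X 0 → Finset (∀ i : Fin r, X i.succ) := fun x =>
      Finset.univ.filter fun y => Fin.cons x y ∈ T with hTx
    -- `Dx x` collects the remaining parameters for which the slice of `T` over `x` contains a
    -- product set, so induction applies to each slice.
    set Dx : X 0 → Finset (∀ i : Fin r, E i.succ) := fun x =>
      Finset.univ.filter fun d => ∃ l : ∀ i : Fin r, Set (X i.succ),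
        (∀ i, l i ∈ L i.succ (d i)) ∧ Set.univ.pi l ⊆ Tx x with hDx
    have hTcard : T.card = ∑ x, (Tx x).card := by
      rw [Finset.card_eq_sum_card_fiberwise (f := fun z => z 0) (t := Finset.univ) (by simp)]
      refine Finset.sum_congr rfl fun x _ => ?_
      refine Finset.card_bij' (fun z _ => Fin.tail z) (fun y _ => Fin.cons x y) ?_ ?_ ?_ ?_
      · rintro z hz
        obtain ⟨hz, rfl⟩ := Finset.mem_filter.1 hz
        simpa [hTx] using hz
      · intro y hy
        simpa [hTx] using hy
      · rintro z hz
        obtain ⟨hz, rfl⟩ := Finset.mem_filter.1 hz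
        simp
      · simp
    have hDcard : D.card =
        ∑ d : ∀ i : Fin r, E i.succ, (Finset.univ.filter fun c : E 0 => Fin.cons c d ∈ D).card := by
      rw [Finset.card_eq_sum_card_fiberwise (f := fun z => Fin.tail z) (t := Finset.univ) (by simp)]
      refine Finset.sum_congr rfl fun d _ => ?_
      refine Finset.card_bij' (fun z _ => z 0) (fun c _ => Fin.cons c d) ?_ ?_ ?_ ?_
      · rintro z hz
        obtain ⟨hz, rfl⟩ := Finset.mem_filter.1 hz
        simpa using hz
      · intro c hc
        simpa using hc
      · rintro z hz
        obtain ⟨hz, rfl⟩ := Finset.mem_filter.1 hz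
        simp
      · simp
    -- For fixed `d`, the points `x` with `d ∈ Dx x` contain a member of `L 0 c` whenever `(c, d) ∈
    -- D`, so the bound for the first factor applies.
    have hK : ∀ d : ∀ i : Fin r, E i.succ,
        κ 0 * (Finset.univ.filter fun c : E 0 => Fin.cons c d ∈ D).card ≤
          (Finset.univ.filter fun x => d ∈ Dx x).card := by
      intro d
      refine hL 0 _ _ fun c hc => ?_
      obtain ⟨l, hl, hlT⟩ := hT _ (Finset.mem_filter.1 hc).2
      refine ⟨l 0, by simpa using hl 0, fun x hx => ?_⟩
      simp only [hDx, Finset.coe_filter, Finset.mem_filter, Finset.mem_univ, true_and,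
        Set.mem_ofPred_eq]
      refine ⟨fun i => l i.succ, fun i => by simpa using hl i.succ, fun y hy => ?_⟩
      simp only [hTx, Finset.coe_filter, Finset.mem_univ, true_and, Set.mem_ofPred_eq]
      refine hlT fun i _ => ?_
      refine Fin.cases ?_ (fun i => ?_) i
      · simpa using hx
      · simpa using hy i trivial
    have hswap : ∑ x, (Dx x).card =
        ∑ d : ∀ i : Fin r, E i.succ, (Finset.univ.filter fun x => d ∈ Dx x).card := by
      simp_rw [Finset.card_filter]
      rw [Finset.sum_comm]
      simp
    have hκ' : 0 ≤ ∏ i : Fin r, κ i.succ := Finset.prod_nonneg fun i _ => hκ _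
    calc (∏ i, κ i) * (D.card : ℝ)
        = (∏ i : Fin r, κ i.succ) * ∑ d : ∀ i : Fin r, E i.succ,
            κ 0 * (Finset.univ.filter fun c : E 0 => Fin.cons c d ∈ D).card := by
          rw [hDcard, Fin.prod_univ_succ, ← Finset.mul_sum]
          push_cast
          ring
      _ ≤ (∏ i : Fin r, κ i.succ) * ∑ d : ∀ i : Fin r, E i.succ,
            ((Finset.univ.filter fun x => d ∈ Dx x).card : ℝ) :=
          mul_le_mul_of_nonneg_left (Finset.sum_le_sum fun d _ => hK d) hκ'
      _ = ∑ x, (∏ i : Fin r, κ i.succ) * ((Dx x).card : ℝ) := by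
          rw [← Finset.mul_sum]
          exact_mod_cast congrArg (fun k : ℕ => (∏ i : Fin r, κ i.succ) * (k : ℝ)) hswap.symm
      _ ≤ ∑ x, ((Tx x).card : ℝ) :=
          Finset.sum_le_sum fun x _ => ih (Tx x) (Dx x) fun d hd => (Finset.mem_filter.1 hd).2
      _ = T.card := by rw [hTcard]; push_cast; rfl

/-! ### Chinese remainder theorem and the bound for square-free moduli. -/

theorem reduceMod_add_smul {r n : ℕ} (p : Fin r → ℕ) (i : Fin r)
    (a b : Fin n → ZMod (∏ i, p i)) (t : ZMod (∏ i, p i)) :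
    reduceMod p i (a + t • b) = reduceMod p i a +
      ZMod.castHom (Finset.dvd_prod_of_mem p (Finset.mem_univ i)) (ZMod (p i)) t •
        reduceMod p i b := by
  funext j
  simp only [reduceMod, Pi.add_apply, Pi.smul_apply, smul_eq_mul, map_add, map_mul]

theorem exists_forall_castHom_eq {r : ℕ} (p : Fin r → ℕ) [∀ i, Fact (p i).Prime]
    (hinj : Function.Injective p) (t : ∀ i, ZMod (p i)) :
    ∃ s : ZMod (∏ i, p i), ∀ i,
      ZMod.castHom (Finset.dvd_prod_of_mem p (Finset.mem_univ i)) (ZMod (p i)) s = t i := by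
  have hco : Pairwise (Function.onFun Nat.Coprime p) := fun i j hij =>
    (Nat.coprime_primes (Fact.out (p := (p i).Prime)) Fact.out).2 fun h => hij (hinj h)
  obtain ⟨s, hs⟩ := (ZMod.prodEquivPi p hco).surjective t
  exact ⟨s, fun i => by rw [← ZMod.prodEquivPi_apply p hco, hs]⟩

theorem IsKakeya.exists_lines {r n : ℕ} {p : Fin r → ℕ} [∀ i, Fact (p i).Prime]
    (hinj : Function.Injective p) {S : Set (Fin (n + 1) → ZMod (∏ i, p i))} (hS : IsKakeya p S)
    (c : ∀ i, Fin n → ZMod (p i)) :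
    ∃ a : ∀ i, Fin (n + 1) → ZMod (p i), Set.univ.pi (fun i => line (a i) (Fin.cons 1 (c i))) ⊆
      (fun x i => reduceMod p i x) '' S := by
  have hne : ∀ i, (Fin.cons 1 (c i) : Fin (n + 1) → ZMod (p i)) ≠ 0 := fun i h => by
    simpa using congrFun h 0
  obtain ⟨b, hb, a, ha⟩ := hS fun i => Projectivization.mk (ZMod (p i)) _ (hne i)
  have hu : ∀ i, ∃ u : ZMod (p i), u • reduceMod p i b = Fin.cons 1 (c i) := fun i => by
    obtain ⟨h, hi⟩ := hb i
    exact (Projectivization.mk_eq_mk_iff' _ _ _ _ _).1 hi.symm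
  choose u hu using hu
  refine ⟨fun i => reduceMod p i a, fun y hy => ?_⟩
  choose t ht using fun i => hy i trivial
  -- Independent parameters `t i` on the component lines come from a single `s`; `u i` corrects the
  -- scaling of the representative `b`.
  obtain ⟨s, hs⟩ := exists_forall_castHom_eq p hinj fun i => t i * u i
  refine ⟨a + s • b, ha ⟨s, rfl⟩, funext fun i => ?_⟩
  simp only [reduceMod_add_smul, hs, mul_smul, hu]
  exact (ht i).symm

theorem IsKakeya.le_card {r n : ℕ} (hn : 1 ≤ n) {p : Fin r → ℕ} [∀ i, Fact (p i).Prime]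
    (hinj : Function.Injective p) {S : Finset (Fin n → ZMod (∏ i, p i))}
    (hS : IsKakeya p (S : Set (Fin n → ZMod (∏ i, p i)))) :
    ((∏ i, p i : ℕ) : ℝ) ^ n / ∏ i, (2 - 1 / (p i : ℝ)) ^ n ≤ S.card := by
  classical
  obtain ⟨n, rfl⟩ : ∃ k, n = k + 1 := ⟨n - 1, by omega⟩
  have hp0 : ∀ i, (0 : ℝ) < p i := fun i => by exact_mod_cast (Fact.out : (p i).Prime).pos
  have hfac : ∀ i, (0 : ℝ) < 2 - 1 / (p i : ℝ) := fun i => by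
    have : (2 : ℝ) ≤ p i := by exact_mod_cast (Fact.out : (p i).Prime).two_le
    rw [sub_pos, div_lt_iff₀ (hp0 i)]
    linarith
  have key := prod_mul_card_le_card (X := fun i => Fin (n + 1) → ZMod (p i))
    (E := fun i => Fin n → ZMod (p i)) (fun i c => {l | ∃ a, l = line a (Fin.cons 1 c)})
    (fun i => (p i : ℝ) / (2 - 1 / p i) ^ (n + 1))
    (fun i => (div_pos (hp0 i) (pow_pos (hfac i) _)).le)
    (fun i T D h => div_mul_card_le T D fun c hc => by
      obtain ⟨_, ⟨a, rfl⟩, ha⟩ := h c hc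
      exact ⟨a, fun t => ha ⟨t, rfl⟩⟩)
    (S.image fun x i => reduceMod p i x) Finset.univ fun c _ => by
      obtain ⟨a, ha⟩ := hS.exists_lines hinj c
      exact ⟨_, fun i => ⟨a i, rfl⟩, by simpa using ha⟩
  refine le_trans (le_of_eq ?_) (key.trans (by exact_mod_cast Finset.card_image_le))
  rw [Finset.card_univ, Fintype.card_pi]
  simp only [Fintype.card_fun, ZMod.card, Fintype.card_fin]
  push_cast
  rw [← Finset.prod_pow, ← Finset.prod_div_distrib, ← Finset.prod_mul_distrib]
  refine Finset.prod_congr rfl fun i _ => ?_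
  rw [pow_succ' (p i : ℝ)]
  ring

theorem prod_two_sub_pow_le {r : ℕ} (n : ℕ) (p : Fin r → ℕ) [∀ i, Fact (p i).Prime] :
    0 < ∏ i, (2 - 1 / (p i : ℝ)) ^ n ∧ ∏ i, (2 - 1 / (p i : ℝ)) ^ n ≤ 2 ^ (r * n) := by
  have hfac : ∀ i, (0 : ℝ) < 2 - 1 / (p i : ℝ) ∧ 2 - 1 / (p i : ℝ) ≤ 2 := fun i => by
    have : (2 : ℝ) ≤ p i := by exact_mod_cast (Fact.out : (p i).Prime).two_le
    have h1 : 1 / (p i : ℝ) ≤ 1 := by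
      rw [div_le_one (by linarith)]
      linarith
    have h2 : 0 ≤ 1 / (p i : ℝ) := by positivity
    constructor <;> linarith
  refine ⟨Finset.prod_pos fun i _ => pow_pos (hfac i).1 _, ?_⟩
  refine (Finset.prod_le_prod (fun i _ => (pow_pos (hfac i).1 _).le)
    fun i _ => pow_le_pow_left₀ (hfac i).1.le (hfac i).2 n).trans (le_of_eq ?_)
  rw [Finset.prod_const, Finset.card_univ, Fintype.card_fin, ← pow_mul, mul_comm]

/-! ### Absorbing `2 ^ (r * n)` into `N ^ ε`. -/

theorem exists_two_pow_mul_le (n : ℕ) {ε : ℝ} (hε : 0 < ε) : ∃ K : ℝ, 0 < K ∧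
    ∀ (r : ℕ) (p : Fin r → ℕ), (∀ i, 0 < p i) → Function.Injective p →
      (2 : ℝ) ^ (r * n) ≤ K * ((∏ i, p i : ℕ) : ℝ) ^ ε := by
  -- Each `p i ≥ B` satisfies `2 ^ n ≤ (p i) ^ ε`; by injectivity at most `B` indices have `p i <
  -- B`, and each costs a factor `2 ^ n`.
  obtain ⟨B, hB⟩ := exists_nat_ge (((2 : ℝ) ^ n) ^ ε⁻¹)
  refine ⟨((2 : ℝ) ^ n) ^ B, by positivity, fun r p hp hinj => ?_⟩
  have h1 : ∀ i, (2 : ℝ) ^ n ≤ (if p i < B then 2 ^ n else 1) * (p i : ℝ) ^ ε := fun i => by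
    split_ifs with h
    · refine le_mul_of_one_le_right (by positivity) (Real.one_le_rpow ?_ hε.le)
      exact_mod_cast hp i
    · rw [one_mul]
      have h2 : (((2 : ℝ) ^ n) ^ ε⁻¹) ≤ p i := hB.trans (by exact_mod_cast not_lt.1 h)
      have h3 := Real.rpow_le_rpow (by positivity) h2 hε.le
      rwa [← Real.rpow_mul (by positivity), inv_mul_cancel₀ hε.ne', Real.rpow_one] at h3
  have hcard : (Finset.univ.filter fun i => p i < B).card ≤ B := by
    have := Finset.card_le_card_of_injOn (s := Finset.univ.filter fun i => p i < B)
      (t := Finset.range B) p (fun i hi => by simpa using hi) hinj.injOn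
    simpa using this
  calc (2 : ℝ) ^ (r * n) = ∏ _i : Fin r, (2 : ℝ) ^ n := by
        rw [Finset.prod_const, Finset.card_univ, Fintype.card_fin, ← pow_mul, mul_comm]
    _ ≤ ∏ i, ((if p i < B then 2 ^ n else 1) * (p i : ℝ) ^ ε) :=
        Finset.prod_le_prod (fun _ _ => by positivity) fun i _ => h1 i
    _ = (∏ i, if p i < B then (2 : ℝ) ^ n else 1) * ((∏ i, p i : ℕ) : ℝ) ^ ε := by
        rw [Finset.prod_mul_distrib, Real.finsetProd_rpow _ _ fun i _ => Nat.cast_nonneg _]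
        push_cast
        rfl
    _ ≤ _ := by
        refine mul_le_mul_of_nonneg_right ?_ (by positivity)
        rw [← Finset.prod_filter, Finset.prod_const]
        exact pow_le_pow_right₀ (one_le_pow₀ (by norm_num)) hcard

theorem mainTheorem1 (n : ℕ) (hn : 1 ≤ n) :
    (∀ (r : ℕ) (p : Fin r → ℕ) [∀ i, Fact (p i).Prime], Function.Injective p →
      ∀ S : Finset (Fin n → ZMod (∏ i, p i)), IsKakeya p (S : Set (Fin n → ZMod (∏ i, p i))) →
        (S.card : ℝ) ≥ ((∏ i, p i : ℕ) : ℝ) ^ n / ∏ i, (2 - 1 / (p i : ℝ)) ^ n ∧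
        ((∏ i, p i : ℕ) : ℝ) ^ n / ∏ i, (2 - 1 / (p i : ℝ)) ^ n ≥
          ((∏ i, p i : ℕ) : ℝ) ^ n / 2 ^ (r * n)) ∧
    (∀ ε : ℝ, 0 < ε → ∃ C : ℝ, 0 < C ∧
      ∀ (r : ℕ) (p : Fin r → ℕ) [∀ i, Fact (p i).Prime], Function.Injective p →
        ∀ S : Finset (Fin n → ZMod (∏ i, p i)), IsKakeya p (S : Set (Fin n → ZMod (∏ i, p i))) →
          (S.card : ℝ) ≥ C * ((∏ i, p i : ℕ) : ℝ) ^ ((n : ℝ) - ε)) := by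
  have h1 : ∀ (r : ℕ) (p : Fin r → ℕ) [∀ i, Fact (p i).Prime],
      ((∏ i, p i : ℕ) : ℝ) ^ n / 2 ^ (r * n) ≤
        ((∏ i, p i : ℕ) : ℝ) ^ n / ∏ i, (2 - 1 / (p i : ℝ)) ^ n := fun r p _ =>
    div_le_div_of_nonneg_left (by positivity) (prod_two_sub_pow_le n p).1
      (prod_two_sub_pow_le n p).2
  refine ⟨fun r p _ hinj S hS => ⟨hS.le_card hn hinj, h1 r p⟩, fun ε hε => ?_⟩
  obtain ⟨K, hK, hle⟩ := exists_two_pow_mul_le n hε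
  refine ⟨K⁻¹, inv_pos.2 hK, fun r p _ hinj S hS => ?_⟩
  refine le_trans ?_ ((h1 r p).trans (hS.le_card hn hinj))
  have hp : ∀ i, 0 < p i := fun i => (Fact.out : (p i).Prime).pos
  have hN : (0 : ℝ) < ((∏ i, p i : ℕ) : ℝ) := by exact_mod_cast Finset.prod_pos fun i _ => hp i
  have h2 := hle r p hp hinj
  rw [Real.rpow_sub hN, Real.rpow_natCast, le_div_iff₀ (by positivity)]
  have hNε : (0 : ℝ) < ((∏ i, p i : ℕ) : ℝ) ^ ε := Real.rpow_pos_of_pos hN ε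
  calc K⁻¹ * (((∏ i, p i : ℕ) : ℝ) ^ n / ((∏ i, p i : ℕ) : ℝ) ^ ε) * 2 ^ (r * n)
      ≤ K⁻¹ * (((∏ i, p i : ℕ) : ℝ) ^ n / ((∏ i, p i : ℕ) : ℝ) ^ ε) *
          (K * ((∏ i, p i : ℕ) : ℝ) ^ ε) := mul_le_mul_of_nonneg_left h2 (by positivity)
    _ = ((∏ i, p i : ℕ) : ℝ) ^ n := by field_simp
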